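/- **Setting.** Let $d\in\mathbb N$, $t_0<T$, $\alpha_U>0$, let $K\subset[t_0,T]$ be compact, and let $r\in[1,\infty)$. Write $\phi(t,c,s)=\exp(-\alpha_U\,s\,(t-c)^2)$. For each $N$ let $\tau^{N}_1,\dots,\tau^{N}_N\in\mathbb R$ be deterministic centers that become dense in $[t_0,T]$: for all $s\in[t_0,T]$ and $\varepsilon>0$ there is $N_0$ such that for every $N\ge N_0$ some $j\le N$ has $|\tau^N_j-s|<\varepsilon$ (for instance the equidistant centers $\tau^N_j=t_0+\frac jN(T-t_0)$). Let $\theta_1,\theta_2,\dots$ be i.i.d. real random variables on a probability space $(\Omega,\mathcal F,P)$ with values a.s. in a set $\Theta\subset[0,\infty)$ that contains a positive number, and with full support: $P(|\theta_1-s|<\varepsilon)>0$ for all $s\in\Theta$, $\varepsilon>0$ (for instance $\theta_j\sim\mathcal U[0,1]$ with $\Theta=[0,1]$). Let $\mathcal F_\Theta=\sigma(\theta_1,\theta_2,\dots)$. Spaces $C(K;\mathbb R^d)$ carry the supremum norm and $\mathbb R^d$ the Euclidean norm. **Claim (a): density.** The random functions $\sum_{j=1}^N w_j\,\phi(\cdot,\tau^N_j,\theta_j)$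 with $\mathcal F_\Theta$-measurable weights $w_j:\Omega\to\mathbb R^d$ are dense in the Bochner space $L^r(\Omega,\mathcal F_\Theta,P;C(K;\mathbb R^d))$. More precisely, for every $G$ in this space and every $\varepsilon>0$ there is $N_0$ such that for every $N\ge N_0$ there are $\mathcal F_\Theta$-measurable weights $w_1,\dots,w_N$ for which $\sum_{j=1}^N w_j\,\phi(\cdot,\tau^N_j,\theta_j)$ belongs to $L^r(\Omega;C(K;\mathbb R^d))$ and $$\Big\|\sum_{j=1}^N w_j\,\phi(\cdot,\tau^N_j,\theta_j)-G\Big\|_{L^r(\Omega;C(K;\mathbb R^d))}<\varepsilon .$$ **Claim (b): approximation of solutions of initial value problems.** Let $u_0\in\mathbb R^d$ and let $f:\mathbb R\times\mathbb R^d\to\mathbb R^d$ be such that $t\mapsto f(t,x)$ is continuous on $[t_0,T]$ for every $x$, and $f(t,\cdot)$ is Lipschitz on each ball, with a constant that is uniform in $t\in[t_0,T]$. Consider $$u'(t)=f(t,u(t)),\quad t\in[t_0,T],\qquad u(t_0)=u_0 .$$ There is at most one solution on $[t_0,T]$, and there is one if $f(t,\cdot)$ is Lipschitz on all of $\mathbb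 R^d$ with a constant uniform in $t\in[t_0,T]$. Whenever $u$ is a solution on $[t_0,T]$, for every $\varepsilon>0$ there is $N_0$ such that for every $N\ge N_0$ there are random weights $w_1,\dots,w_N:\Omega\to\mathbb R^d$, measurable with respect to $\sigma(\theta_1,\dots,\theta_N)$, for which the random projection network $$\hat u(t)=u_0+(t-t_0)\sum_{j=1}^N w_j\,\phi(t,\tau^N_j,\theta_j)$$ belongs to $L^r(\Omega;C(K;\mathbb R^d))$ and satisfies $$\|\hat u-u\|_{L^r(\Omega;C(K;\mathbb R^d))}=\Big(\mathbb E\,\sup_{t\in K}\|\hat u(t)-u(t)\|^r\Big)^{1/r}<\varepsilon .$$ -/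

import Mathlib

open MeasureTheory ProbabilityTheory Set TopologicalSpace
open scoped ENNReal NNReal

/-- The Gaussian radial basis function with shape parameter `s`, centre `c` and scale `α`,
`φ(t, c, s) = exp (-α s (t - c)²)`. -/
noncomputable def gaussFeature (α t c s : ℝ) : ℝ := Real.exp (-α * s * (t - c) ^ 2)

/-- The expansion `t ↦ ∑ⱼ wⱼ φ(t, τⱼ, θⱼ)` with vector weights `wⱼ ∈ ℝᵈ`, as an element of
`C(K; ℝᵈ)`. -/
noncomputable def rbfSum {d N : ℕ} (K : Compacts ℝ) (α : ℝ) (τ θ : Fin N → ℝ)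
    (w : Fin N → EuclideanSpace ℝ (Fin d)) : C(K, EuclideanSpace ℝ (Fin d)) where
  toFun t := ∑ j, gaussFeature α (t : ℝ) (τ j) (θ j) • w j
  continuous_toFun := by unfold gaussFeature; fun_prop

/-- The random projection network `t ↦ u₀ + (t - t₀) ∑ⱼ wⱼ φ(t, τⱼ, θⱼ)`, as an element of
`C(K; ℝᵈ)`. Its `k`-th component is `u₀⁽ᵏ⁾ + (t - t₀) ∑ⱼ wⱼₖ φ(t, τⱼ, θⱼ)`. -/
noncomputable def rpnn {d N : ℕ} (K : Compacts ℝ) (t₀ : ℝ) (u₀ : EuclideanSpace ℝ (Fin d))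
    (α : ℝ) (τ θ : Fin N → ℝ) (w : Fin N → EuclideanSpace ℝ (Fin d)) :
    C(K, EuclideanSpace ℝ (Fin d)) where
  toFun t := u₀ + ((t : ℝ) - t₀) • rbfSum K α τ θ w t
  continuous_toFun := by fun_prop

/-- `u` solves `u' = f(t, u)` on `[t₀, T]`, `u(t₀) = u₀` (one-sided derivatives at the ends). -/
structure IsIVPSolution {d : ℕ} (f : ℝ → EuclideanSpace ℝ (Fin d) → EuclideanSpace ℝ (Fin d))
    (t₀ T : ℝ) (u₀ : EuclideanSpace ℝ (Fin d)) (u : ℝ → EuclideanSpace ℝ (Fin d)) : Prop where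
  initial : u t₀ = u₀
  hasDeriv : ∀ t ∈ Icc t₀ T, HasDerivWithinAt u (f t (u t)) (Icc t₀ T) t

/-- A solution on `[t₀, T]`, restricted to a compact `K ⊆ [t₀, T]`, as an element of
`C(K; ℝᵈ)`. -/
def IsIVPSolution.toC {d : ℕ} {f : ℝ → EuclideanSpace ℝ (Fin d) → EuclideanSpace ℝ (Fin d)}
    {t₀ T : ℝ} {u₀ : EuclideanSpace ℝ (Fin d)} {u : ℝ → EuclideanSpace ℝ (Fin d)}
    (hu : IsIVPSolution f t₀ T u₀ u) {K : Compacts ℝ} (hK : (K : Set ℝ) ⊆ Icc t₀ T) :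
    C(K, EuclideanSpace ℝ (Fin d)) where
  toFun t := u t
  continuous_toFun := continuousOn_iff_continuous_domRestrict.mp
    (show ContinuousOn u (K : Set ℝ) from
      fun t ht => ((hu.hasDeriv t (hK ht)).continuousWithinAt).mono hK)

/-- The Lipschitz condition in the state variable: on every ball, `f t` is Lipschitz with a
constant that is uniform in `t ∈ [t₀, T]`. -/
def LocallyLipschitzInState {d : ℕ}
    (f : ℝ → EuclideanSpace ℝ (Fin d) → EuclideanSpace ℝ (Fin d)) (t₀ T : ℝ) : Prop :=
  ∀ R : ℝ, ∃ L : ℝ≥0, ∀ t ∈ Icc t₀ T, LipschitzOnWith L (f t) (Metric.closedBall 0 R)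

/-- The global Lipschitz condition in the state variable, uniform in `t ∈ [t₀, T]`. -/
def GloballyLipschitzInState {d : ℕ}
    (f : ℝ → EuclideanSpace ℝ (Fin d) → EuclideanSpace ℝ (Fin d)) (t₀ T : ℝ) : Prop :=
  ∃ L : ℝ≥0, ∀ t ∈ Icc t₀ T, LipschitzWith L (f t)

/-- The deterministic centres `τ N 0, …, τ N (N - 1)` become dense in `[t₀, T]` as `N → ∞`. -/
def CentersFill (t₀ T : ℝ) (τ : (N : ℕ) → Fin N → ℝ) : Prop :=
  ∀ s ∈ Icc t₀ T, ∀ ε > 0, ∃ N₀ : ℕ, ∀ N ≥ N₀, ∃ j : Fin N, |τ N j - s| < ε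

/-- Equidistant centres `t₀ + (j / N) (T - t₀)`, `j = 1, …, N`, satisfy `CentersFill`. -/
theorem centersFill_equidistant (t₀ T : ℝ) :
    CentersFill t₀ T (fun N j => t₀ + (((j : ℕ) : ℝ) + 1) / N * (T - t₀)) := by
  intro s hs ε hε
  obtain ⟨hs0, hs1⟩ := hs
  obtain ⟨M, hM⟩ := exists_nat_gt ((T - t₀) / ε)
  refine ⟨M + 1, fun N hN => ?_⟩
  have hN0 : 0 < N := by omega
  have hNr : (0 : ℝ) < N := by exact_mod_cast hN0
  have hNM : (M : ℝ) + 1 ≤ N := by exact_mod_cast hN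
  have hstep : (T - t₀) / N < ε := by
    rw [div_lt_iff₀ hNr]
    rw [div_lt_iff₀ hε] at hM
    nlinarith
  rcases hs1.lt_or_eq with hlt | rfl
  · have hL : 0 < T - t₀ := by linarith
    have hx0 : 0 ≤ (s - t₀) / (T - t₀) * N := by
      have : 0 ≤ s - t₀ := by linarith
      positivity
    have hx1 : (s - t₀) / (T - t₀) * N < N := by
      have : (s - t₀) / (T - t₀) < 1 := by rw [div_lt_one hL]; linarith
      nlinarith
    set x := (s - t₀) / (T - t₀) * N with hx
    have hfl := Nat.floor_le hx0
    have hfl' := Nat.lt_floor_add_one x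
    refine ⟨⟨⌊x⌋₊, by exact_mod_cast hfl.trans_lt hx1⟩, ?_⟩
    have hs' : s = t₀ + x / N * (T - t₀) := by rw [hx]; field_simp; ring
    have key : t₀ + ((⌊x⌋₊ : ℝ) + 1) / N * (T - t₀) - s
        = ((⌊x⌋₊ : ℝ) + 1 - x) * ((T - t₀) / N) := by
      have : t₀ + ((⌊x⌋₊ : ℝ) + 1) / N * (T - t₀) - (t₀ + x / N * (T - t₀))
        = ((⌊x⌋₊ : ℝ) + 1 - x) * ((T - t₀) / N) := by ring
      rwa [← hs'] at this
    have hpos : 0 < (T - t₀) / N := by positivity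
    simp only
    rw [key, abs_of_nonneg (by apply mul_nonneg <;> linarith)]
    nlinarith
  · refine ⟨⟨N - 1, by omega⟩, ?_⟩
    have : ((N - 1 : ℕ) : ℝ) + 1 = N := by
      rw [Nat.cast_sub hN0]; simp
    simp only
    rw [this, div_self hNr.ne']
    simpa using hε

/-- `θ₀, θ₁, …` are i.i.d. real random variables with values in `Θ`, whose common law charges
every neighbourhood of every point of `Θ` (full support). -/
structure IsShapeSample {Ω : Type*} [MeasurableSpace Ω] (P : Measure Ω) (Θ : Set ℝ)
    (θ : ℕ → Ω → ℝ) : Prop where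
  measurable : ∀ j, Measurable (θ j)
  indep : iIndepFun θ P
  ident : ∀ j, IdentDistrib (θ j) (θ 0) P P
  mem : ∀ j, ∀ᵐ ω ∂P, θ j ω ∈ Θ
  full_support : ∀ s ∈ Θ, ∀ ε > 0, 0 < P {ω | |θ 0 ω - s| < ε}

/-- The σ-algebra generated by the first `N` shape parameters. -/
abbrev sigmaFirst {Ω : Type*} (θ : ℕ → Ω → ℝ) (N : ℕ) : MeasurableSpace Ω :=
  ⨆ j : Fin N, MeasurableSpace.comap (θ j) inferInstance

/-- The σ-algebra generated by all shape parameters. -/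
abbrev sigmaAll {Ω : Type*} (θ : ℕ → Ω → ℝ) : MeasurableSpace Ω :=
  ⨆ j : ℕ, MeasurableSpace.comap (θ j) inferInstance

/-! ### Density of Gaussians with a fixed shape parameter and centres in an interval -/

/-! Only one positive shape `s ∈ Θ` is needed. For this `s`, the Gaussian factors as `φ(t,c,s) =
exp(-αst²) · exp(2αsct) · exp(-αsc²)`, so a closed subspace of `C(K)` containing all `φ(·,c,s)`, `c
∈ [t₀,T]`, contains `exp(-αst²) exp(lt)` for `l` in an open interval. Differentiating in `l`
produces the factors `tⁿ`; Weierstrass and division by the nowhere vanishing exponentials then give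
all of `C(K)` (`gaussMap_closed_submodule_eq_top`), and coordinates give `C(K;ℝᵈ)`.

A target `φ(·,c,s)v` is imitated by averaging the available features with centre near `c` and random
shape near `s` (`isApproximable_indicator_gaussVec`). The average is uniformly close to the target
unless none of the sampled shapes attached to nearby centres is near `s`. By independence this has
probability `pⁿ`, where `p < 1` by full support and `n`, the number of nearby centres, tends to
infinity. Linearity and density pass to indicator multiples of elements of `C(K;ℝᵈ)`, then to simple
functions, and so to all of `Lʳ`.

For the initial value problem, `u(t) = u₀ + (t - t₀) g(t)` with `g` continuous, and the constant
random variable `g` is approximated. No event enters except the whole space, so weights depending on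
the first `N` shapes suffice; this is why `IsApproximable` carries a family `m N` of σ-algebras. -/

theorem Submodule.hasDerivAt_mem {F : Type*} [NormedAddCommGroup F] [NormedSpace ℝ F]
    {V : Submodule ℝ F} (hV : IsClosed (V : Set F)) {f : ℝ → F} {f' : F} {x : ℝ}
    (hf : HasDerivAt f f' x) (hmem : ∀ᶠ y in nhds x, f y ∈ V) : f' ∈ V := by
  have hx : f x ∈ V := hmem.self_of_nhds
  refine hV.mem_of_tendsto hf.tendsto_slope ?_
  filter_upwards [hmem.filter_mono nhdsWithin_le_nhds] with y hy
  exact V.smul_mem _ (V.sub_mem hy hx)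

/-- Each derivative in `l` brings down one factor `X`, and the derivative of a `V`-valued curve is a
limit of difference quotients, hence stays in the closed subspace. Openness of `U` keeps the curve
in `V` near `l`. -/
theorem Submodule.pow_mul_exp_mem {A : Type*} [NormedCommRing A] [NormedAlgebra ℝ A]
    [CompleteSpace A] {V : Submodule ℝ A} (hV : IsClosed (V : Set A)) (X : A) {U : Set ℝ}
    (hU : IsOpen U) (h : ∀ l ∈ U, NormedSpace.exp (l • X) ∈ V) (n : ℕ) :
    ∀ l ∈ U, X ^ n * NormedSpace.exp (l • X) ∈ V := by
  induction n with
  | zero => simpa using h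
  | succ n ih =>
    intro l hl
    have hd : HasDerivAt (fun y : ℝ => X ^ n * NormedSpace.exp (y • X))
        (X ^ n * (NormedSpace.exp (l • X) * X)) l :=
      (hasDerivAt_exp_smul_const (𝕂 := ℝ) X l).const_mul (X ^ n)
    have := Submodule.hasDerivAt_mem hV hd
      (by filter_upwards [hU.mem_nhds hl] with y hy using ih y hy)
    convert this using 1
    ring

theorem ContinuousMap.exp_apply {X : Type*} [TopologicalSpace X] [CompactSpace X] (g : C(X, ℝ))
    (t : X) : NormedSpace.exp g t = Real.exp (g t) := by
  rw [Real.exp_eq_exp_ℝ]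
  let _ : NormedAlgebra ℚ C(X, ℝ) := NormedAlgebra.restrictScalars ℚ ℝ C(X, ℝ)
  exact NormedSpace.map_exp (ContinuousMap.evalAlgHom ℝ ℝ t) (continuous_eval_const t) g

/-- `t ↦ φ(t, c, s)` as an element of `C(K)`. -/
noncomputable def gaussMap (K : Compacts ℝ) (α c s : ℝ) : C(K, ℝ) where
  toFun t := gaussFeature α t c s
  continuous_toFun := by unfold gaussFeature; fun_prop

theorem polynomial_closed_submodule_eq_top (K : Compacts ℝ) {V : Submodule ℝ C(K, ℝ)}
    (hV : IsClosed (V : Set C(K, ℝ)))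
    (h : ∀ n : ℕ, (⟨fun t => (t : ℝ), by fun_prop⟩ : C(K, ℝ)) ^ n ∈ V) : V = ⊤ := by
  have hp : ∀ p : Polynomial ℝ, p.toContinuousMapOn (K : Set ℝ) ∈ V := by
    intro p
    induction p using Polynomial.induction_on' with
    | add p q hp hq =>
      rw [show (p + q).toContinuousMapOn (K : Set ℝ) = p.toContinuousMapOn (K : Set ℝ)
        + q.toContinuousMapOn (K : Set ℝ) from
          ContinuousMap.ext fun t => Polynomial.eval_add]
      exact V.add_mem hp hq
    | monomial n a =>
      rw [show (Polynomial.monomial n a).toContinuousMapOn (K : Set ℝ)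
        = a • (⟨fun t => (t : ℝ), by fun_prop⟩ : C(K, ℝ)) ^ n from
          ContinuousMap.ext fun t => Polynomial.eval_monomial]
      exact V.smul_mem a (h n)
  rw [eq_top_iff]
  intro g _
  have hcomp : CompactSpace (K : Set ℝ) := inferInstanceAs (CompactSpace K)
  have hg : g ∈ (polynomialFunctions (K : Set ℝ)).topologicalClosure := by
    rw [polynomialFunctions.topologicalClosure]; trivial
  refine closure_minimal ?_ hV hg
  rintro _ ⟨p, -, rfl⟩
  exact hp p

theorem gaussMap_closed_submodule_eq_top (K : Compacts ℝ) {t₀ T α s : ℝ} (hT : t₀ < T)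
    (hα : 0 < α) (hs : 0 < s) {V : Submodule ℝ C(K, ℝ)} (hV : IsClosed (V : Set C(K, ℝ)))
    (h : ∀ c ∈ Icc t₀ T, gaussMap K α c s ∈ V) : V = ⊤ := by
  set X : C(K, ℝ) := ⟨fun t => (t : ℝ), by fun_prop⟩ with hX
  have hXt : ∀ t, X t = t := fun _ => rfl
  set g₀ : C(K, ℝ) := NormedSpace.exp ((-(α * s)) • X ^ 2) with hg₀
  have hb : 0 < 2 * α * s := by positivity
  have mulc : ∀ g : C(K, ℝ), Continuous (LinearMap.mulLeft ℝ g) := fun g =>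
    continuous_const.mul continuous_id
  set V₁ := V.comap (LinearMap.mulLeft ℝ g₀) with hV₁
  have hV₁c : IsClosed (V₁ : Set C(K, ℝ)) := hV.preimage (mulc g₀)
  have hU : ∀ l ∈ Ioo (2 * α * s * t₀) (2 * α * s * T), NormedSpace.exp (l • X) ∈ V₁ := by
    intro l hl
    have hc : l / (2 * α * s) ∈ Icc t₀ T :=
      ⟨(le_div_iff₀ hb).2 (by linarith [hl.1]), (div_le_iff₀ hb).2 (by linarith [hl.2])⟩
    set c := l / (2 * α * s) with hcdef
    have hl' : l = 2 * α * s * c := by rw [hcdef]; field_simp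
    have := V.smul_mem (Real.exp (α * s * c ^ 2)) (h c hc)
    change g₀ * NormedSpace.exp (l • X) ∈ V
    convert this using 1
    ext t
    simp only [hg₀, ContinuousMap.mul_apply, ContinuousMap.exp_apply, ContinuousMap.smul_apply,
      ContinuousMap.pow_apply, smul_eq_mul, hXt, gaussMap, gaussFeature, ContinuousMap.coe_mk,
      ← Real.exp_add]
    rw [hl']
    ring_nf
  -- The midpoint of the interval of admissible exponents; any interior point would do.
  set l := α * s * (t₀ + T) with hl
  have hlm : l ∈ Ioo (2 * α * s * t₀) (2 * α * s * T) := by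
    have : 0 < α * s := by positivity
    constructor <;> nlinarith
  set g₁ : C(K, ℝ) := NormedSpace.exp (l • X) with hg₁
  set V₂ := V₁.comap (LinearMap.mulLeft ℝ g₁) with hV₂
  have hV₂top : V₂ = ⊤ := by
    refine polynomial_closed_submodule_eq_top K (hV₁c.preimage (mulc g₁)) fun n => ?_
    have := Submodule.pow_mul_exp_mem hV₁c X isOpen_Ioo hU n l hlm
    rw [mul_comm] at this
    exact this
  rw [eq_top_iff]
  intro g _
  -- The exponential here is the inverse of `g₀ * g₁`, so multiplying back recovers `g`.
  have : NormedSpace.exp ((α * s) • X ^ 2 - l • X) * g ∈ V₂ := by rw [hV₂top]; trivial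
  change g₀ * (g₁ * (_ * g)) ∈ V at this
  convert this using 1
  ext t
  simp only [hg₀, hg₁, ContinuousMap.mul_apply, ContinuousMap.exp_apply, ContinuousMap.smul_apply,
      ContinuousMap.pow_apply, ContinuousMap.sub_apply, smul_eq_mul, hXt]
  rw [← mul_assoc, ← mul_assoc, ← Real.exp_add, ← Real.exp_add]
  ring_nf
  simp

/-- `t ↦ φ(t, c, s) v` as an element of `C(K; ℝᵈ)`. -/
noncomputable def gaussVec {d : ℕ} (K : Compacts ℝ) (α c s : ℝ) (v : EuclideanSpace ℝ (Fin d)) :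
    C(K, EuclideanSpace ℝ (Fin d)) where
  toFun t := gaussFeature α t c s • v
  continuous_toFun := by unfold gaussFeature; fun_prop

theorem dense_span_gaussVec {d : ℕ} (K : Compacts ℝ) {t₀ T α s : ℝ} (hT : t₀ < T)
    (hα : 0 < α) (hs : 0 < s) :
    Dense (Submodule.span ℝ {g | ∃ c ∈ Icc t₀ T, ∃ v : EuclideanSpace ℝ (Fin d),
      g = gaussVec K α c s v} : Set C(K, EuclideanSpace ℝ (Fin d))) := by
  set W := Submodule.span ℝ {g | ∃ c ∈ Icc t₀ T, ∃ v : EuclideanSpace ℝ (Fin d),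
      g = gaussVec K α c s v} with hW
  rw [Submodule.dense_iff_topologicalClosure_eq_top]
  have key : ∀ (v : EuclideanSpace ℝ (Fin d)) (g : C(K, ℝ)),
      ContinuousLinearMap.compLeftContinuous ℝ K (ContinuousLinearMap.toSpanSingleton ℝ v) g
        ∈ W.topologicalClosure := by
    intro v g
    have hmain : W.topologicalClosure.comap (ContinuousLinearMap.compLeftContinuous ℝ K
        (ContinuousLinearMap.toSpanSingleton ℝ v)).toLinearMap = ⊤ := by
      refine gaussMap_closed_submodule_eq_top K hT hα hs
        (W.isClosed_topologicalClosure.preimage (ContinuousLinearMap.continuous _)) ?_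
      intro c hc
      refine W.le_topologicalClosure (Submodule.subset_span ⟨c, hc, v, ?_⟩)
      ext t
      simp [gaussVec, gaussMap]
    have : g ∈ (⊤ : Submodule ℝ C(K, ℝ)) := trivial
    rw [← hmain] at this
    exact this
  rw [eq_top_iff]
  intro g _
  have : g = ∑ i, ContinuousLinearMap.compLeftContinuous ℝ K
      (ContinuousLinearMap.toSpanSingleton ℝ (EuclideanSpace.basisFun (Fin d) ℝ i))
      ⟨fun t => g t i, by fun_prop⟩ := by
    ext t : 1
    rw [ContinuousMap.sum_apply]
    exact ((EuclideanSpace.basisFun (Fin d) ℝ).sum_repr (g t)).symm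
  rw [this]
  exact Submodule.sum_mem _ fun i _ => key _ _

/-! ### Existence and uniqueness for the initial value problem -/

theorem IsIVPSolution.continuousOn {d : ℕ}
    {f : ℝ → EuclideanSpace ℝ (Fin d) → EuclideanSpace ℝ (Fin d)} {t₀ T : ℝ}
    {u₀ : EuclideanSpace ℝ (Fin d)} {u : ℝ → EuclideanSpace ℝ (Fin d)}
    (hu : IsIVPSolution f t₀ T u₀ u) : ContinuousOn u (Icc t₀ T) :=
  fun t ht => (hu.hasDeriv t ht).continuousWithinAt

theorem HasDerivWithinAt.Ici_of_Icc {E : Type*} [NormedAddCommGroup E] [NormedSpace ℝ E]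
    {u : ℝ → E} {u' : E} {a b t : ℝ} (h : HasDerivWithinAt u u' (Icc a b) t)
    (ht : t ∈ Ico a b) : HasDerivWithinAt u u' (Ici t) t :=
  h.mono_of_mem_nhdsWithin (Filter.mem_of_superset (Icc_mem_nhdsGE ht.2)
    (Icc_subset_Icc_left ht.1))

theorem IsIVPSolution.unique {d : ℕ}
    {f : ℝ → EuclideanSpace ℝ (Fin d) → EuclideanSpace ℝ (Fin d)} {t₀ T : ℝ}
    {u₀ : EuclideanSpace ℝ (Fin d)} {u v : ℝ → EuclideanSpace ℝ (Fin d)}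
    (hf : LocallyLipschitzInState f t₀ T)
    (hu : IsIVPSolution f t₀ T u₀ u) (hv : IsIVPSolution f t₀ T u₀ v) :
    EqOn u v (Icc t₀ T) := by
  -- Both solutions are bounded on the compact interval, so one ball with one Lipschitz constant
  -- contains them and the local condition is enough.
  obtain ⟨R₁, hR₁⟩ := isCompact_Icc.exists_bound_of_continuousOn hu.continuousOn
  obtain ⟨R₂, hR₂⟩ := isCompact_Icc.exists_bound_of_continuousOn hv.continuousOn
  obtain ⟨L, hL⟩ := hf (max R₁ R₂)
  refine ODE_solution_unique_of_mem_Icc_right (v := f) (K := L)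
    (s := fun _ => Metric.closedBall 0 (max R₁ R₂))
    (fun t ht => hL t (Ico_subset_Icc_self ht))
    hu.continuousOn (fun t ht => (hu.hasDeriv t (Ico_subset_Icc_self ht)).Ici_of_Icc ht)
    (fun t ht => ?_)
    hv.continuousOn (fun t ht => (hv.hasDeriv t (Ico_subset_Icc_self ht)).Ici_of_Icc ht)
    (fun t ht => ?_) (hu.initial.trans hv.initial.symm)
  · simpa using Or.inl (hR₁ t (Ico_subset_Icc_self ht))
  · simpa using Or.inr (hR₂ t (Ico_subset_Icc_self ht))

/-- The cut-off function equal to `1` on the ball of radius `R` and to `0` outside the ball of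
radius `R + 1`. -/
def ballCutoff {E : Type*} [NormedAddCommGroup E] (R : ℝ) (x : E) : ℝ :=
  max 0 (min 1 (R + 1 - ‖x‖))

theorem ballCutoff_nonneg {E : Type*} [NormedAddCommGroup E] (R : ℝ) (x : E) :
    0 ≤ ballCutoff R x := le_max_left _ _

theorem ballCutoff_le_one {E : Type*} [NormedAddCommGroup E] (R : ℝ) (x : E) :
    ballCutoff R x ≤ 1 := max_le zero_le_one (min_le_left _ _)

theorem ballCutoff_eq_one {E : Type*} [NormedAddCommGroup E] {R : ℝ} {x : E} (h : ‖x‖ ≤ R) :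
    ballCutoff R x = 1 := by
  rw [ballCutoff, min_eq_left (by linarith), max_eq_right zero_le_one]

theorem ballCutoff_eq_zero {E : Type*} [NormedAddCommGroup E] {R : ℝ} {x : E} (h : R + 1 ≤ ‖x‖) :
    ballCutoff R x = 0 := by
  rw [ballCutoff, max_eq_left ((min_le_right _ _).trans (by linarith))]

theorem abs_ballCutoff_sub_le {E : Type*} [NormedAddCommGroup E] (R : ℝ) (x y : E) :
    |ballCutoff R x - ballCutoff R y| ≤ ‖x - y‖ := by
  have h := abs_norm_sub_norm_le x y
  rw [abs_le] at h ⊢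
  unfold ballCutoff
  rcases h with ⟨h₁, h₂⟩
  have := norm_nonneg (x - y)
  constructor <;> grind

/-- Cutting `f` off outside a large ball makes it bounded, so Picard–Lindelöf reaches the whole
interval at once. The cut-off field still obeys the linear growth bound of `f`, so Gronwall confines
its solution to the ball where nothing was changed. -/
theorem exists_isIVPSolution_of_globallyLipschitz {d : ℕ}
    {f : ℝ → EuclideanSpace ℝ (Fin d) → EuclideanSpace ℝ (Fin d)} {t₀ T : ℝ} (hT : t₀ < T)
    (u₀ : EuclideanSpace ℝ (Fin d)) (hc : ∀ x, ContinuousOn (fun t => f t x) (Icc t₀ T))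
    (hf : GloballyLipschitzInState f t₀ T) : ∃ u, IsIVPSolution f t₀ T u₀ u := by
  obtain ⟨L, hL⟩ := hf
  obtain ⟨M, hM⟩ := isCompact_Icc.exists_bound_of_continuousOn (hc 0)
  have hM0 : 0 ≤ M := (norm_nonneg _).trans (hM t₀ (left_mem_Icc.2 hT.le))
  have hgrow : ∀ t ∈ Icc t₀ T, ∀ x, ‖f t x‖ ≤ L * ‖x‖ + M := by
    intro t ht x
    have h₁ := (hL t ht).norm_sub_le x 0
    have h₂ := norm_sub_norm_le (f t x) (f t 0)
    have h₃ := hM t ht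
    rw [sub_zero] at h₁
    linarith
  -- `R` is the a priori bound from `‖u'‖ ≤ L‖u‖ + M`. Below, `B` bounds the cut-off field, which
  -- vanishes where `‖x‖ ≥ R + 1`; `A` is the farthest a curve of speed at most `B` can travel, and
  -- `C` bounds `f` on the ball of radius `A` about `u₀`.
  set R : ℝ := gronwallBound ‖u₀‖ L M (T - t₀) with hR
  have hR0 : 0 ≤ R := by
    have := gronwallBound_mono (norm_nonneg u₀) hM0 L.2 (sub_nonneg.2 hT.le)
    rw [gronwallBound_x0] at this
    exact (norm_nonneg _).trans this
  set B : ℝ := L * (R + 1) + M with hB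
  have hB0 : 0 ≤ B := by positivity
  set g : ℝ → EuclideanSpace ℝ (Fin d) → EuclideanSpace ℝ (Fin d) :=
    fun t x => ballCutoff R x • f t x with hg
  have hnorm : ∀ t x, ‖g t x‖ = ballCutoff R x * ‖f t x‖ := fun t x => by
    rw [hg, norm_smul, Real.norm_of_nonneg (ballCutoff_nonneg R x)]
  have hgle : ∀ t x, ‖g t x‖ ≤ ‖f t x‖ := fun t x => by
    rw [hnorm]
    exact mul_le_of_le_one_left (norm_nonneg _) (ballCutoff_le_one R x)
  have hgB : ∀ t ∈ Icc t₀ T, ∀ x, ‖g t x‖ ≤ B := by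
    intro t ht x
    rcases le_total (R + 1) ‖x‖ with h | h
    · rw [hnorm, ballCutoff_eq_zero h, zero_mul]; exact hB0
    · refine (hgle t x).trans ((hgrow t ht x).trans ?_)
      rw [hB]
      gcongr
  set A : ℝ := B * (T - t₀) with hA
  have hA0 : 0 ≤ A := mul_nonneg hB0 (sub_nonneg.2 hT.le)
  set C : ℝ := L * (‖u₀‖ + A) + M with hC
  have hC0 : 0 ≤ C := by positivity
  have hPL : IsPicardLindelof g (⟨t₀, left_mem_Icc.2 hT.le⟩ : Icc t₀ T) u₀
      ⟨A, hA0⟩ 0 ⟨B, hB0⟩ (⟨C, hC0⟩ + L) := by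
    refine ⟨fun t ht => LipschitzOnWith.of_dist_le_mul fun x hx y hy => ?_,
      fun x _ => (hc x).const_smul (ballCutoff R x), fun t ht x _ => hgB t ht x, ?_⟩
    · have hx' : ‖f t x‖ ≤ C := by
        refine (hgrow t ht x).trans ?_
        have : ‖x‖ ≤ ‖u₀‖ + A := by
          have h₁ : ‖x - u₀‖ ≤ A := mem_closedBall_iff_norm.1 hx
          have h₂ := norm_sub_norm_le x u₀
          linarith
        rw [hC]
        gcongr
      rw [dist_eq_norm, dist_eq_norm]
      -- Product rule for Lipschitz constants: the cut-off varies at rate `1` against `‖f‖ ≤ C`, and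
      -- `f` varies at rate `L` against a cut-off at most `1`.
      have hsplit : g t x - g t y = (ballCutoff R x - ballCutoff R y) • f t x
          + ballCutoff R y • (f t x - f t y) := by
        simp only [hg]; module
      rw [hsplit]
      refine (norm_add_le _ _).trans ?_
      rw [norm_smul, norm_smul, Real.norm_eq_abs, Real.norm_of_nonneg (ballCutoff_nonneg R y)]
      have h₁ := abs_ballCutoff_sub_le R x y
      have h₂ := (hL t ht).norm_sub_le x y
      have h₃ := ballCutoff_le_one R y
      have h₄ : |ballCutoff R x - ballCutoff R y| * ‖f t x‖ ≤ ‖x - y‖ * C := by gcongr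
      have h₅ : ballCutoff R y * ‖f t x - f t y‖ ≤ 1 * (L * ‖x - y‖) := by gcongr
      calc _ ≤ ‖x - y‖ * C + 1 * (L * ‖x - y‖) := add_le_add h₄ h₅
        _ = (C + L) * ‖x - y‖ := by ring
        _ = _ := rfl
    · simp only [sub_self, max_eq_left (sub_nonneg.2 hT.le), NNReal.coe_zero, sub_zero]
      exact le_rfl
  obtain ⟨u, hu₀, hu⟩ := hPL.exists_eq_forall_mem_Icc_hasDerivWithinAt₀
  have hcont : ContinuousOn u (Icc t₀ T) := fun t ht => (hu t ht).continuousWithinAt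
  have hbound : ∀ t ∈ Icc t₀ T, ‖u t‖ ≤ R := by
    intro t ht
    refine (norm_le_gronwallBound_of_norm_deriv_right_le (K := L) (ε := M) hcont
      (fun x hx => (hu x (Ico_subset_Icc_self hx)).Ici_of_Icc hx) (δ := ‖u₀‖)
      (le_of_eq (congrArg norm hu₀)) (fun x hx => (hgle x (u x)).trans
        (hgrow x (Ico_subset_Icc_self hx) (u x))) t ht).trans ?_
    exact gronwallBound_mono (norm_nonneg u₀) hM0 L.2 (by linarith [ht.2])
  refine ⟨u, hu₀, fun t ht => ?_⟩
  have := hu t ht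
  simpa only [hg, ballCutoff_eq_one (hbound t ht), one_smul] using this

/-! ### Random features near a prescribed centre and shape -/

/-- Density supplies one centre per interval; many come from halving: `M` in the left half by
induction, and a further one in the right half, within `(b - a)/4` of its midpoint `(a + 3b)/4`. -/
theorem CentersFill.eventually_le_card_Ioo {t₀ T : ℝ} {τ : (N : ℕ) → Fin N → ℝ}
    (hτ : CentersFill t₀ T τ) (M : ℕ) : ∀ a b : ℝ, t₀ ≤ a → a < b → b ≤ T →
      ∃ N₀ : ℕ, ∀ N ≥ N₀, M ≤ (Finset.univ.filter fun j => τ N j ∈ Ioo a b).card := by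
  induction M with
  | zero => exact fun _ _ _ _ _ => ⟨0, fun _ _ => Nat.zero_le _⟩
  | succ M ih =>
    intro a b ha hab hb
    obtain ⟨N₁, h₁⟩ := ih a ((a + b) / 2) ha (by linarith) (by linarith)
    obtain ⟨N₂, h₂⟩ := hτ ((a + 3 * b) / 4) ⟨by linarith, by linarith⟩ ((b - a) / 4) (by linarith)
    refine ⟨max N₁ N₂, fun N hN => ?_⟩
    obtain ⟨j, hj⟩ := h₂ N (le_of_max_le_right hN)
    rw [abs_lt] at hj
    refine (Nat.succ_le_succ (h₁ N (le_of_max_le_left hN))).trans (Finset.card_lt_card ?_)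
    refine (Finset.ssubset_iff_of_subset fun i hi => ?_).2 ⟨j, ?_, ?_⟩
    · simp only [Finset.mem_filter, Finset.mem_univ, true_and, mem_Ioo] at hi ⊢
      exact ⟨hi.1, by linarith [hi.2]⟩
    · simp only [Finset.mem_filter, Finset.mem_univ, true_and, mem_Ioo]
      constructor <;> linarith
    · simp only [Finset.mem_filter, Finset.mem_univ, true_and, mem_Ioo, not_and]
      intro; linarith

theorem CentersFill.eventually_le_card_ball {t₀ T : ℝ} (hT : t₀ < T) {τ : (N : ℕ) → Fin N → ℝ}
    (hτ : CentersFill t₀ T τ) {c : ℝ} (hc : c ∈ Icc t₀ T) {δ : ℝ} (hδ : 0 < δ) (M : ℕ) :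
    ∃ N₀ : ℕ, ∀ N ≥ N₀, M ≤ (Finset.univ.filter fun j => |τ N j - c| < δ).card := by
  -- The ball is intersected with `[t₀, T]`, which leaves a nondegenerate interval even if `c` is an
  -- endpoint.
  obtain ⟨N₀, h⟩ := hτ.eventually_le_card_Ioo M (max t₀ (c - δ)) (min T (c + δ))
    (le_max_left _ _)
    (max_lt (lt_min hT (by linarith [hc.1])) (lt_min (by linarith [hc.2]) (by linarith)))
    (min_le_left _ _)
  refine ⟨N₀, fun N hN => (h N hN).trans (Finset.card_le_card fun j hj => ?_)⟩
  simp only [Finset.mem_filter, Finset.mem_univ, true_and, mem_Ioo, max_lt_iff, lt_min_iff] at hj ⊢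
  rw [abs_lt]
  constructor <;> linarith [hj.1.2, hj.2.2]

theorem IsShapeSample.measure_iInter_preimage {Ω : Type*} [MeasurableSpace Ω] {P : Measure Ω}
    {Θ : Set ℝ} {θ : ℕ → Ω → ℝ} (hθ : IsShapeSample P Θ θ) {B : Set ℝ} (hB : MeasurableSet B)
    {N : ℕ} (J : Finset (Fin N)) :
    P (⋂ j ∈ J, θ j ⁻¹' B) = P (θ 0 ⁻¹' B) ^ J.card := by
  have h := hθ.indep.measure_inter_preimage_eq_mul (J.map Fin.valEmbedding) (sets := fun _ => B)
    (fun _ _ => hB)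
  simp only [(hθ.ident _).measure_mem_eq hB, Finset.prod_const, Finset.card_map] at h
  rw [← h]
  congr 1
  ext ω
  simp

/-! ### Linear structure and measurability of the feature sums -/

theorem rbfSum_add {d N : ℕ} (K : Compacts ℝ) (α : ℝ) (τ θ : Fin N → ℝ)
    (w w' : Fin N → EuclideanSpace ℝ (Fin d)) :
    rbfSum K α τ θ (fun j => w j + w' j) = rbfSum K α τ θ w + rbfSum K α τ θ w' := by
  ext t : 1
  simp [rbfSum, smul_add, Finset.sum_add_distrib]

theorem rbfSum_smul_const {d N : ℕ} (K : Compacts ℝ) (α : ℝ) (τ θ : Fin N → ℝ) (a : Fin N → ℝ)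
    (v : EuclideanSpace ℝ (Fin d)) :
    rbfSum K α τ θ (fun j => a j • v) = ∑ j, a j • gaussVec K α (τ j) (θ j) v := by
  ext t : 1
  simp only [rbfSum, gaussVec, ContinuousMap.coe_mk, ContinuousMap.sum_apply,
    ContinuousMap.smul_apply]
  exact Finset.sum_congr rfl fun j _ => smul_comm _ _ _

theorem rbfSum_zero {d N : ℕ} (K : Compacts ℝ) (α : ℝ) (τ θ : Fin N → ℝ) :
    rbfSum K α τ θ (fun _ => (0 : EuclideanSpace ℝ (Fin d))) = 0 := by
  ext t : 1
  simp [rbfSum]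

theorem continuous_rbfSum {d N : ℕ} (K : Compacts ℝ) (α : ℝ) (τ : Fin N → ℝ) :
    Continuous fun p : (Fin N → ℝ) × (Fin N → EuclideanSpace ℝ (Fin d)) =>
      rbfSum K α τ p.1 p.2 := by
  refine ContinuousMap.continuous_of_continuous_uncurry _ ?_
  simp only [Function.uncurry_def, rbfSum, gaussFeature, ContinuousMap.coe_mk]
  fun_prop

theorem stronglyMeasurable_rbfSum {d N : ℕ} (K : Compacts ℝ) (α : ℝ) (τ : Fin N → ℝ)
    {Ω : Type*} [MeasurableSpace Ω] {θ : ℕ → Ω → ℝ} (hθ : ∀ j, Measurable (θ j))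
    {w : Fin N → Ω → EuclideanSpace ℝ (Fin d)} (hw : ∀ j, Measurable (w j)) :
    StronglyMeasurable fun ω => rbfSum K α τ (fun j => θ j ω) (fun j => w j ω) :=
  (continuous_rbfSum K α τ).comp_stronglyMeasurable
    (f := fun ω => ((fun j : Fin N => θ j ω), fun j => w j ω))
    (Measurable.stronglyMeasurable
      ((measurable_pi_lambda _ fun j : Fin N => hθ j).prodMk (measurable_pi_lambda _ hw)))

theorem continuous_rpnn {d N : ℕ} (K : Compacts ℝ) (t₀ : ℝ) (u₀ : EuclideanSpace ℝ (Fin d)) (α : ℝ)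
    (τ : Fin N → ℝ) :
    Continuous fun p : (Fin N → ℝ) × (Fin N → EuclideanSpace ℝ (Fin d)) =>
      rpnn K t₀ u₀ α τ p.1 p.2 := by
  refine ContinuousMap.continuous_of_continuous_uncurry _ ?_
  simp only [Function.uncurry_def, rpnn, rbfSum, gaussFeature, ContinuousMap.coe_mk]
  fun_prop

theorem stronglyMeasurable_rpnn {d N : ℕ} (K : Compacts ℝ) (t₀ : ℝ)
    (u₀ : EuclideanSpace ℝ (Fin d)) (α : ℝ) (τ : Fin N → ℝ)
    {Ω : Type*} [MeasurableSpace Ω] {θ : ℕ → Ω → ℝ} (hθ : ∀ j, Measurable (θ j))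
    {w : Fin N → Ω → EuclideanSpace ℝ (Fin d)} (hw : ∀ j, Measurable (w j)) :
    StronglyMeasurable fun ω => rpnn K t₀ u₀ α τ (fun j => θ j ω) (fun j => w j ω) :=
  (continuous_rpnn K t₀ u₀ α τ).comp_stronglyMeasurable
    (f := fun ω => ((fun j : Fin N => θ j ω), fun j => w j ω))
    (Measurable.stronglyMeasurable
      ((measurable_pi_lambda _ fun j : Fin N => hθ j).prodMk (measurable_pi_lambda _ hw)))

theorem continuous_gaussVec {d : ℕ} (K : Compacts ℝ) (α : ℝ) (v : EuclideanSpace ℝ (Fin d)) :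
    Continuous fun p : ℝ × ℝ => gaussVec K α p.1 p.2 v := by
  refine ContinuousMap.continuous_of_continuous_uncurry _ ?_
  simp only [Function.uncurry_def, gaussVec, gaussFeature, ContinuousMap.coe_mk]
  fun_prop

/-! ### Approximation in the Bochner space -/

/-- `G` is the limit in `Lʳ(Ω; C(K; ℝᵈ))` of feature sums whose weights, for `N` features, are
measurable with respect to `m N`. -/
def IsApproximable {d : ℕ} {Ω : Type*} [MeasurableSpace Ω] (K : Compacts ℝ) (α : ℝ)
    (τ : (N : ℕ) → Fin N → ℝ) (P : Measure Ω) (θ : ℕ → Ω → ℝ) (r : ℝ≥0∞)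
    (m : ℕ → MeasurableSpace Ω) (G : Ω → C(K, EuclideanSpace ℝ (Fin d))) : Prop :=
  ∀ ε : ℝ≥0∞, ε ≠ 0 → ∃ N₀ : ℕ, ∀ N ≥ N₀, ∃ w : Fin N → Ω → EuclideanSpace ℝ (Fin d),
    (∀ j, Measurable[m N] (w j)) ∧
    eLpNorm (fun ω => rbfSum K α (τ N) (fun j => θ j ω) (fun j => w j ω) - G ω) r P ≤ ε

section

variable {d : ℕ} {Ω : Type*} [mΩ : MeasurableSpace Ω] {K : Compacts ℝ} {α : ℝ}
  {τ : (N : ℕ) → Fin N → ℝ} {P : Measure Ω} {θ : ℕ → Ω → ℝ} {r : ℝ≥0∞}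
  {m : ℕ → MeasurableSpace Ω}

theorem IsApproximable.add (hr : 1 ≤ r) (hθ : ∀ j, Measurable (θ j)) (hm : ∀ N, m N ≤ mΩ)
    {G₁ G₂ : Ω → C(K, EuclideanSpace ℝ (Fin d))}
    (hG₁ : AEStronglyMeasurable G₁ P) (hG₂ : AEStronglyMeasurable G₂ P)
    (h₁ : IsApproximable K α τ P θ r m G₁) (h₂ : IsApproximable K α τ P θ r m G₂) :
    IsApproximable K α τ P θ r m (G₁ + G₂) := by
  intro ε hε
  have hε2 : ε / 2 ≠ 0 := by simpa using hε
  obtain ⟨N₁, h₁⟩ := h₁ _ hε2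
  obtain ⟨N₂, h₂⟩ := h₂ _ hε2
  refine ⟨max N₁ N₂, fun N hN => ?_⟩
  obtain ⟨w₁, hw₁, hn₁⟩ := h₁ N (le_of_max_le_left hN)
  obtain ⟨w₂, hw₂, hn₂⟩ := h₂ N (le_of_max_le_right hN)
  refine ⟨fun j ω => w₁ j ω + w₂ j ω, fun j => (hw₁ j).add (hw₂ j), ?_⟩
  have hs₁ := (stronglyMeasurable_rbfSum K α (τ N) hθ
    fun j => (hw₁ j).mono (hm N) le_rfl).aestronglyMeasurable (μ := P)
  have hs₂ := (stronglyMeasurable_rbfSum K α (τ N) hθ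
    fun j => (hw₂ j).mono (hm N) le_rfl).aestronglyMeasurable (μ := P)
  have := (eLpNorm_add_le (hs₁.sub hG₁) (hs₂.sub hG₂) hr).trans
    ((add_le_add hn₁ hn₂).trans_eq (ENNReal.add_halves ε))
  refine (congrArg (eLpNorm · r P) (funext fun ω => ?_)).trans_le this
  simp only [rbfSum_add, Pi.add_apply, Pi.sub_apply]
  abel

/-- Serves both passages to the limit: from the span of Gaussians to `C(K;ℝᵈ)`, and from simple
functions to `Lʳ`. -/
theorem IsApproximable.of_closure (hr : 1 ≤ r) (hθ : ∀ j, Measurable (θ j)) (hm : ∀ N, m N ≤ mΩ)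
    {G : Ω → C(K, EuclideanSpace ℝ (Fin d))} (hG : AEStronglyMeasurable G P)
    (h : ∀ ε : ℝ≥0∞, ε ≠ 0 → ∃ G' : Ω → C(K, EuclideanSpace ℝ (Fin d)),
      AEStronglyMeasurable G' P ∧ IsApproximable K α τ P θ r m G' ∧
        eLpNorm (fun ω => G' ω - G ω) r P ≤ ε) :
    IsApproximable K α τ P θ r m G := by
  intro ε hε
  have hε2 : ε / 2 ≠ 0 := by simpa using hε
  obtain ⟨G', hG', happ, hn⟩ := h _ hε2
  obtain ⟨N₀, h₀⟩ := happ _ hε2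
  refine ⟨N₀, fun N hN => ?_⟩
  obtain ⟨w, hw, hn'⟩ := h₀ N hN
  refine ⟨w, hw, ?_⟩
  have hs := (stronglyMeasurable_rbfSum K α (τ N) hθ
    fun j => (hw j).mono (hm N) le_rfl).aestronglyMeasurable (μ := P)
  have := (eLpNorm_add_le (hs.sub hG') (hG'.sub hG) hr).trans
    ((add_le_add hn' hn).trans_eq (ENNReal.add_halves ε))
  refine (congrArg (eLpNorm · r P) (funext fun ω => ?_)).trans_le this
  simp

theorem isApproximable_zero : IsApproximable K α τ P θ r m
    (fun _ => (0 : C(K, EuclideanSpace ℝ (Fin d)))) := by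
  intro ε _
  refine ⟨0, fun N _ => ⟨fun _ _ => 0, fun _ => measurable_const, ?_⟩⟩
  refine (eLpNorm_le_of_ae_bound (C := 0) (ae_of_all _ fun ω => ?_)).trans (by simp)
  rw [rbfSum_zero, sub_zero, norm_zero]

end

theorem exists_mul_pow_rpow_le {C p ε r : ℝ≥0∞} (hC : C ≠ ∞) (hp : p < 1) (hε : ε ≠ 0)
    (hr : r ≠ 0) (hr' : r ≠ ∞) : ∃ M : ℕ, ∀ n ≥ M, C * (p ^ n) ^ (1 / r.toReal) ≤ ε := by
  have hr0 : 0 < 1 / r.toReal := one_div_pos.2 (ENNReal.toReal_pos hr hr')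
  have h₁ : Filter.Tendsto (fun n : ℕ => C * (p ^ n) ^ (1 / r.toReal)) Filter.atTop (nhds 0) := by
    have h₂ := ((ENNReal.continuous_rpow_const (y := 1 / r.toReal)).tendsto 0).comp
      (ENNReal.tendsto_pow_atTop_nhds_zero_of_lt_one hp)
    rw [ENNReal.zero_rpow_of_pos hr0] at h₂
    simpa using ENNReal.Tendsto.const_mul h₂ (Or.inr hC)
  obtain ⟨M, hM⟩ := Filter.eventually_atTop.1 (h₁.eventually (ge_mem_nhds (pos_iff_ne_zero.2 hε)))
  exact ⟨M, hM⟩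

theorem norm_sum_smul_sub_le {ι F : Type*} [Fintype ι] [NormedAddCommGroup F] [NormedSpace ℝ F]
    {q : ι → ℝ} (hq : ∀ i, 0 ≤ q i) (hq1 : ∑ i, q i = 1) {x : ι → F} {y : F} {η : ℝ}
    (h : ∀ i, q i ≠ 0 → ‖x i - y‖ ≤ η) : ‖∑ i, q i • x i - y‖ ≤ η := by
  have : ∑ i, q i • x i - y = ∑ i, q i • (x i - y) := by
    simp only [smul_sub, Finset.sum_sub_distrib, ← Finset.sum_smul, hq1, one_smul]
  rw [this]
  calc ‖∑ i, q i • (x i - y)‖ ≤ ∑ i, ‖q i • (x i - y)‖ := norm_sum_le _ _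
    _ ≤ ∑ i, q i * η := Finset.sum_le_sum fun i _ => by
        rw [norm_smul, Real.norm_of_nonneg (hq i)]
        rcases eq_or_ne (q i) 0 with h0 | h0
        · simp [h0]
        · exact mul_le_mul_of_nonneg_left (h i h0) (hq i)
    _ = η := by rw [← Finset.sum_mul, hq1, one_mul]

section

variable {d : ℕ} {t₀ T α : ℝ} {Ω : Type*} [mΩ : MeasurableSpace Ω] {K : Compacts ℝ}
  {τ : (N : ℕ) → Fin N → ℝ} {P : Measure Ω} [IsProbabilityMeasure P] {Θ : Set ℝ}
  {θ : ℕ → Ω → ℝ} {r : ℝ≥0∞} {m : ℕ → MeasurableSpace Ω}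

/-- The average of the features whose centre is `δ`-close to `c` and whose random shape parameter
is `δ`-close to `s` approximates `φ(·, c, s) v`. -/
theorem isApproximable_indicator_gaussVec (hT : t₀ < T) (hτ : CentersFill t₀ T τ)
    (hθ : IsShapeSample P Θ θ) (hr : 1 ≤ r) (hr' : r ≠ ∞)
    (hm' : ∀ N, sigmaFirst θ N ≤ m N) {c s : ℝ} (hc : c ∈ Icc t₀ T) (hs : s ∈ Θ)
    (v : EuclideanSpace ℝ (Fin d)) {S : Set Ω} (hS : ∀ N, MeasurableSet[m N] S) :
    IsApproximable K α τ P θ r m (S.indicator fun _ => gaussVec K α c s v) := by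
  classical
  intro ε hε
  set g := gaussVec K α c s v with hg
  obtain ⟨η, hη0, hηε⟩ : ∃ η : ℝ≥0, 0 < (η : ℝ≥0∞) ∧ (η : ℝ≥0∞) < ε / 2 :=
    ENNReal.lt_iff_exists_nnreal_btwn.1 (pos_iff_ne_zero.2 (by simpa using hε))
  obtain ⟨δ, hδ, hclose⟩ := Metric.continuous_iff.1 (continuous_gaussVec K α v) (c, s) η
    (by exact_mod_cast hη0)
  set B : Set ℝ := {x | |x - s| < δ} with hB
  have hBm : MeasurableSet B := measurableSet_lt (by fun_prop) measurable_const
  have hp : P (θ 0 ⁻¹' Bᶜ) < 1 := by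
    rw [preimage_compl, prob_compl_eq_one_sub (hθ.measurable 0 hBm)]
    exact ENNReal.sub_lt_self ENNReal.one_ne_top one_ne_zero (hθ.full_support s hs δ hδ).ne'
  obtain ⟨M, hM⟩ := exists_mul_pow_rpow_le (C := ‖g‖ₑ) (ε := ε / 2) enorm_ne_top hp
    (by simpa using hε) (zero_lt_one.trans_le hr).ne' hr'
  obtain ⟨N₀, hN₀⟩ := hτ.eventually_le_card_ball hT hc hδ M
  refine ⟨N₀, fun N hN => ?_⟩
  set J : Finset (Fin N) := Finset.univ.filter fun j => |τ N j - c| < δ with hJ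
  have hθm : ∀ j : Fin N, Measurable[m N] (θ j) := fun j =>
    fun U hU => ((le_iSup (fun j : Fin N => MeasurableSpace.comap (θ j) inferInstance) j).trans
      (hm' N)) _ ⟨U, hU, rfl⟩
  -- Selector with values `0` and `1`: the centre is near `c` and the sampled shape is near `s`.
  set q : Fin N → Ω → ℝ := fun j ω =>
    (if j ∈ J then 1 else 0 : ℝ) * B.indicator 1 (θ j ω) with hq
  have hqm : ∀ j, Measurable[m N] (q j) := fun j =>
    ((measurable_one.indicator hBm).const_mul (if j ∈ J then 1 else 0 : ℝ)).comp (hθm j)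
  have hq0 : ∀ j ω, 0 ≤ q j ω := fun j ω => by
    simp only [hq, indicator_apply]
    split_ifs <;> simp
  have hqne : ∀ j ω, q j ω ≠ 0 → |τ N j - c| < δ ∧ |θ j ω - s| < δ := by
    intro j ω h
    simp only [hq, mul_ne_zero_iff, ite_ne_right_iff,
      indicator_apply_ne_zero] at h
    exact ⟨(Finset.mem_filter.1 h.1.1).2, h.2.1⟩
  -- If no feature is selected, `0 / 0 = 0` makes all weights vanish, so on `bad` the error is at
  -- most `‖g‖`.
  set w : Fin N → Ω → EuclideanSpace ℝ (Fin d) :=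
    fun j => S.indicator fun ω => (q j ω / ∑ i, q i ω) • v with hw
  refine ⟨w, fun j => Measurable.indicator (Measurable.smul_const
    ((hqm j).div (Finset.measurable_sum _ fun i _ => hqm i)) v) (hS N), ?_⟩
  set bad : Set Ω := ⋂ j ∈ J, θ j ⁻¹' Bᶜ with hbad
  have hPbad : P bad = P (θ 0 ⁻¹' Bᶜ) ^ J.card := hθ.measure_iInter_preimage hBm.compl J
  have hpt : ∀ ω, ‖rbfSum K α (τ N) (fun j => θ j ω) (fun j => w j ω) - S.indicator (fun _ => g) ω‖
      ≤ ‖(η : ℝ) + bad.indicator (fun _ => ‖g‖) ω‖ := by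
    intro ω
    have hind : 0 ≤ bad.indicator (fun _ => ‖g‖) ω := indicator_nonneg (fun _ _ => norm_nonneg _) _
    rw [Real.norm_of_nonneg (add_nonneg η.coe_nonneg hind)]
    by_cases hωS : ω ∈ S
    swap
    · simp only [hw, indicator_of_notMem hωS, rbfSum_zero, sub_zero, norm_zero]
      exact add_nonneg η.coe_nonneg hind
    simp only [hw, indicator_of_mem hωS]
    by_cases hωb : ω ∈ bad
    · have hq' : ∀ j, q j ω = 0 := by
        intro j
        by_contra h
        have h₁ := hqne j ω h
        exact (mem_iInter₂.1 hωb j (Finset.mem_filter.2 ⟨Finset.mem_univ _, h₁.1⟩)) h₁.2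
      simp only [hq', zero_div, zero_smul, indicator_of_mem hωb]
      rw [rbfSum_zero, zero_sub, norm_neg]
      exact le_add_of_nonneg_left η.coe_nonneg
    · obtain ⟨j, hj, hjB⟩ : ∃ j ∈ J, θ j ω ∈ B := by
        simpa [hbad] using hωb
      have hsum : 0 < ∑ i, q i ω := by
        refine Finset.sum_pos' (fun i _ => hq0 i ω) ⟨j, Finset.mem_univ _, ?_⟩
        simp [hq, hj, indicator_of_mem (hjB)]
      rw [indicator_of_notMem hωb, add_zero, rbfSum_smul_const]
      refine norm_sum_smul_sub_le (fun i => div_nonneg (hq0 i ω) hsum.le) ?_ fun i hi => ?_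
      · rw [← Finset.sum_div, div_self hsum.ne']
      · have h₁ := hqne i ω (div_ne_zero_iff.1 hi).1
        rw [← dist_eq_norm]
        refine (hclose (τ N i, θ i ω) ?_).le
        rw [Prod.dist_eq]
        exact max_lt h₁.1 h₁.2
  have hbadm : MeasurableSet bad :=
    Finset.measurableSet_biInter _ fun j _ => hθ.measurable j hBm.compl
  calc eLpNorm (fun ω => rbfSum K α (τ N) (fun j => θ j ω) (fun j => w j ω)
        - S.indicator (fun _ => g) ω) r P
      ≤ eLpNorm (fun ω => (η : ℝ) + bad.indicator (fun _ => ‖g‖) ω) r P := eLpNorm_mono hpt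
    _ ≤ eLpNorm (fun _ => (η : ℝ)) r P + eLpNorm (bad.indicator fun _ => ‖g‖) r P :=
        eLpNorm_add_le aestronglyMeasurable_const
          (aestronglyMeasurable_const.indicator hbadm) hr
    _ ≤ ε / 2 + ε / 2 := by
        gcongr
        · refine (eLpNorm_le_of_ae_bound (C := η) (by simp)).trans ?_
          simpa using hηε.le
        · refine (eLpNorm_indicator_const_le _ r).trans ?_
          rw [hPbad, enorm_norm]
          exact hM _ (hN₀ N hN)
    _ = ε := ENNReal.add_halves ε

theorem isApproximable_indicator_const (hT : t₀ < T) (hα : 0 < α) (hτ : CentersFill t₀ T τ)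
    (hθ : IsShapeSample P Θ θ) (hr : 1 ≤ r) (hr' : r ≠ ∞) (hΘpos : ∃ s ∈ Θ, 0 < s)
    (hm : ∀ N, m N ≤ mΩ) (hm' : ∀ N, sigmaFirst θ N ≤ m N)
    (g : C(K, EuclideanSpace ℝ (Fin d))) {S : Set Ω} (hS : ∀ N, MeasurableSet[m N] S) :
    IsApproximable K α τ P θ r m (S.indicator fun _ => g) := by
  obtain ⟨s, hs, hs0⟩ := hΘpos
  have hSm : MeasurableSet S := hm 0 S (hS 0)
  have hmeas : ∀ h : C(K, EuclideanSpace ℝ (Fin d)),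
      AEStronglyMeasurable (S.indicator fun _ => h) P := fun h =>
    aestronglyMeasurable_const.indicator hSm
  have hspan : ∀ h ∈ Submodule.span ℝ {g | ∃ c ∈ Icc t₀ T, ∃ v : EuclideanSpace ℝ (Fin d),
      g = gaussVec K α c s v}, IsApproximable K α τ P θ r m (S.indicator fun _ => h) := by
    intro h hh
    induction hh using Submodule.closure_induction with
    | zero =>
      convert isApproximable_zero (d := d) (K := K) (P := P) using 1
      exact indicator_zero _ _
    | add x y _ _ hx hy =>
      rw [show (S.indicator fun _ => x + y) = S.indicator (fun _ => x) + S.indicator fun _ => y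
        from indicator_add _ _ _]
      exact hx.add hr hθ.measurable hm (hmeas x) (hmeas y) hy
    | smul_mem a x hx =>
      obtain ⟨c, hc, v, rfl⟩ := hx
      -- The scalar is absorbed into the free vector `v`, so closure of `IsApproximable` under
      -- scalar multiplication is not needed.
      rw [show a • gaussVec K α c s v = gaussVec K α c s (a • v) by
        exact ContinuousMap.ext fun t => smul_comm a (gaussFeature α t c s) v]
      exact isApproximable_indicator_gaussVec hT hτ hθ hr hr' hm' hc hs _ hS
  refine IsApproximable.of_closure hr hθ.measurable hm (hmeas g) fun ε hε => ?_
  obtain ⟨η, hη0, hηε⟩ := ENNReal.lt_iff_exists_nnreal_btwn.1 (pos_iff_ne_zero.2 hε)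
  obtain ⟨h, hh, hgh⟩ := (dense_span_gaussVec K hT hα hs0).exists_dist_lt g
    (ε := η) (by exact_mod_cast hη0)
  refine ⟨_, hmeas h, hspan h hh, (eLpNorm_le_of_ae_bound (C := η) (ae_of_all _ fun ω => ?_)).trans ?_⟩
  · by_cases hω : ω ∈ S
    · simp only [indicator_of_mem hω]
      rw [← dist_eq_norm, dist_comm]
      exact hgh.le
    · simp [indicator_of_notMem hω]
  · simpa using hηε.le

theorem sigmaFirst_le_sigmaAll {Ω : Type*} (θ : ℕ → Ω → ℝ) (N : ℕ) : sigmaFirst θ N ≤ sigmaAll θ :=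
  iSup_le fun j => le_iSup (fun j : ℕ => MeasurableSpace.comap (θ j) inferInstance) (j : ℕ)

theorem IsShapeSample.sigmaAll_le {P : Measure Ω} (hθ : IsShapeSample P Θ θ) : sigmaAll θ ≤ mΩ :=
  iSup_le fun j => (hθ.measurable j).comap_le

theorem isApproximable_of_memLp (hT : t₀ < T) (hα : 0 < α) (hτ : CentersFill t₀ T τ)
    (hθ : IsShapeSample P Θ θ) (hr : 1 ≤ r) (hr' : r ≠ ∞) (hΘpos : ∃ s ∈ Θ, 0 < s)
    {G : Ω → C(K, EuclideanSpace ℝ (Fin d))} (hG : AEStronglyMeasurable[sigmaAll θ] G P)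
    (hGr : MemLp G r P) : IsApproximable K α τ P θ r (fun _ => sigmaAll θ) G := by
  have hle := hθ.sigmaAll_le
  obtain ⟨G₀, hG₀, hGG₀⟩ := hG
  refine IsApproximable.of_closure hr hθ.measurable (fun _ => hle) hGr.1 fun ε hε => ?_
  have hG₀r : MemLp G₀ r (P.trim hle) :=
    ⟨hG₀.aestronglyMeasurable, by
      rw [eLpNorm_trim hle hG₀, ← eLpNorm_congr_ae hGG₀]; exact hGr.2⟩
  -- Working with the trimmed measure forces the sets in the indicators to be `sigmaAll
  -- θ`-measurable, which keeps the weights measurable for that σ-algebra.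
  obtain ⟨G', hn, hG', happ⟩ := @MemLp.induction_dense Ω _ (sigmaAll θ) _ r (P.trim hle) hr'
    (fun G' => AEStronglyMeasurable[sigmaAll θ] G' (P.trim hle) ∧
      IsApproximable K α τ P θ r (fun _ => sigmaAll θ) G')
    (fun c S hS _ δ hδ => ⟨S.indicator fun _ => c,
      (eLpNorm_le_of_ae_bound (C := 0) (ae_of_all _ fun ω => by simp)).trans (by simp),
      aestronglyMeasurable_const.indicator hS,
      isApproximable_indicator_const hT hα hτ hθ hr hr' hΘpos (fun _ => hle)
        (fun N => sigmaFirst_le_sigmaAll θ N) c fun _ => hS⟩)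
    (fun G₁ G₂ h₁ h₂ => ⟨h₁.1.add h₂.1, h₁.2.add hr hθ.measurable (fun _ => hle)
      (aestronglyMeasurable_of_aestronglyMeasurable_trim hle h₁.1)
      (aestronglyMeasurable_of_aestronglyMeasurable_trim hle h₂.1) h₂.2⟩)
    (fun _ h => h.1) G₀ hG₀r ε hε
  refine ⟨G', aestronglyMeasurable_of_aestronglyMeasurable_trim hle hG', happ, ?_⟩
  rw [eLpNorm_trim_ae hle (hG₀.aestronglyMeasurable.sub hG'), eLpNorm_sub_comm] at hn
  refine (eLpNorm_congr_ae ?_).trans_le hn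
  filter_upwards [hGG₀] with ω hω
  simp [hω]

end

/-! ### The difference quotient of a solution -/

/-- The difference quotient `(u(t) - u(t₀)) / (t - t₀)` of a solution of the initial value problem
extends to an element of `C(K; ℝᵈ)`. -/
theorem IsIVPSolution.exists_slope {d : ℕ}
    {f : ℝ → EuclideanSpace ℝ (Fin d) → EuclideanSpace ℝ (Fin d)} {t₀ T : ℝ} (hT : t₀ < T)
    {u₀ : EuclideanSpace ℝ (Fin d)} {u : ℝ → EuclideanSpace ℝ (Fin d)}
    (hu : IsIVPSolution f t₀ T u₀ u) {K : Compacts ℝ} (hK : (K : Set ℝ) ⊆ Icc t₀ T) :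
    ∃ g : C(K, EuclideanSpace ℝ (Fin d)), ∀ t : K, u t = u₀ + ((t : ℝ) - t₀) • g t := by
  have ht₀ : t₀ ∈ Icc t₀ T := left_mem_Icc.2 hT.le
  -- The value at `t₀` is the one-sided derivative there, which makes the quotient continuous.
  set g : ℝ → EuclideanSpace ℝ (Fin d) := Function.update (slope u t₀) t₀ (f t₀ (u t₀)) with hg
  have hgc : ContinuousOn g (Icc t₀ T) := by
    intro t ht
    rcases eq_or_ne t t₀ with rfl | hne
    · rw [hg, continuousWithinAt_update_same]
      exact hasDerivWithinAt_iff_tendsto_slope.1 (hu.hasDeriv t ht)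
    · rw [hg, continuousWithinAt_update_of_ne hne]
      have h₁ : ContinuousWithinAt (fun x => (x - t₀)⁻¹) (Icc t₀ T) t :=
        ((continuous_id.sub continuous_const).continuousWithinAt).inv₀ (sub_ne_zero.2 hne)
      exact h₁.smul ((hu.continuousOn t ht).sub continuousWithinAt_const)
  refine ⟨⟨fun t => g t, continuousOn_iff_continuous_domRestrict.mp (hgc.mono hK)⟩, fun t => ?_⟩
  change u t = u₀ + ((t : ℝ) - t₀) • g t
  rcases eq_or_ne (t : ℝ) t₀ with h | h
  · rw [h, sub_self, zero_smul, add_zero, hu.initial]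
  · rw [hg, Function.update_of_ne h, sub_smul_slope, vsub_eq_sub, hu.initial, add_sub_cancel]

theorem MeasureTheory.memLp_of_eLpNorm_sub_lt {Ω F : Type*} [MeasurableSpace Ω] {P : Measure Ω}
    [NormedAddCommGroup F] {r ε : ℝ≥0∞} {g h : Ω → F} (hg : AEStronglyMeasurable g P)
    (hh : MemLp h r P) (hlt : eLpNorm (fun ω => g ω - h ω) r P < ε) : MemLp g r P := by
  have hdiff : MemLp (g - h) r P := ⟨hg.sub hh.1, hlt.trans_le le_top⟩
  simpa using hdiff.add hh

/-- Weights realising an approximation, together with the integrability of the feature sum. -/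
theorem IsApproximable.exists_weights {d : ℕ} {α : ℝ} {Ω : Type*} [mΩ : MeasurableSpace Ω]
    {K : Compacts ℝ} {τ : (N : ℕ) → Fin N → ℝ} {P : Measure Ω} {θ : ℕ → Ω → ℝ} {r : ℝ≥0∞}
    {m : ℕ → MeasurableSpace Ω} (hθ : ∀ j, Measurable (θ j)) (hm : ∀ N, m N ≤ mΩ)
    {G : Ω → C(K, EuclideanSpace ℝ (Fin d))} (hG : MemLp G r P)
    (h : IsApproximable K α τ P θ r m G) {ε : ℝ≥0∞} (hε : 0 < ε) :
    ∃ N₀ : ℕ, ∀ N ≥ N₀, ∃ w : Fin N → Ω → EuclideanSpace ℝ (Fin d),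
      (∀ j, Measurable[m N] (w j)) ∧
      MemLp (fun ω => rbfSum K α (τ N) (fun j => θ j ω) (fun j => w j ω)) r P ∧
      eLpNorm (fun ω => rbfSum K α (τ N) (fun j => θ j ω) (fun j => w j ω) - G ω) r P < ε := by
  -- An intermediate `η` turns the bound `≤` of `IsApproximable` into a strict one.
  obtain ⟨η, hη0, hηε⟩ := exists_between hε
  obtain ⟨N₀, h⟩ := h η hη0.ne'
  refine ⟨N₀, fun N hN => ?_⟩
  obtain ⟨w, hw, hn⟩ := h N hN
  have hs := (stronglyMeasurable_rbfSum K α (τ N) hθ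
    fun j => (hw j).mono (hm N) le_rfl).aestronglyMeasurable (μ := P)
  exact ⟨w, hw, memLp_of_eLpNorm_sub_lt hs hG (hn.trans_lt hηε), hn.trans_lt hηε⟩

theorem norm_rpnn_sub_le {d N : ℕ} {t₀ T α : ℝ} (hT : t₀ < T) {K : Compacts ℝ}
    (hK : (K : Set ℝ) ⊆ Icc t₀ T) {u₀ : EuclideanSpace ℝ (Fin d)}
    {g v : C(K, EuclideanSpace ℝ (Fin d))} (hv : ∀ t : K, v t = u₀ + ((t : ℝ) - t₀) • g t)
    (τ θ : Fin N → ℝ) (w : Fin N → EuclideanSpace ℝ (Fin d)) :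
    ‖rpnn K t₀ u₀ α τ θ w - v‖ ≤ (T - t₀) * ‖rbfSum K α τ θ w - g‖ := by
  have hT' : 0 ≤ T - t₀ := sub_nonneg.2 hT.le
  refine (ContinuousMap.norm_le _ (by positivity)).2 fun t => ?_
  have ht := hK t.2
  have : (rpnn K t₀ u₀ α τ θ w - v) t = ((t : ℝ) - t₀) • (rbfSum K α τ θ w - g) t := by
    rw [ContinuousMap.sub_apply, ContinuousMap.sub_apply, hv t, smul_sub]
    exact add_sub_add_left_eq_sub _ _ _
  rw [this, norm_smul, Real.norm_of_nonneg (sub_nonneg.2 ht.1)]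
  exact mul_le_mul (sub_le_sub_right ht.2 _) (ContinuousMap.norm_coe_le_norm _ t)
    (norm_nonneg _) hT'

theorem mainTheorem1 {d : ℕ} {t₀ T α : ℝ} (hT : t₀ < T) (hα : 0 < α)
    (τ : (N : ℕ) → Fin N → ℝ) (hτ : CentersFill t₀ T τ)
    (K : Compacts ℝ) (hK : (K : Set ℝ) ⊆ Icc t₀ T)
    {Ω : Type*} [MeasurableSpace Ω] (P : Measure Ω) [IsProbabilityMeasure P]
    (Θ : Set ℝ) (hΘ : Θ ⊆ Ici 0) (hΘpos : ∃ s ∈ Θ, 0 < s)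
    (θ : ℕ → Ω → ℝ) (hθ : IsShapeSample P Θ θ)
    (r : ℝ≥0∞) (hr : 1 ≤ r) (hr' : r ≠ ∞) :
    -- density of the random feature sums in the Bochner space over the generated σ-algebra
    (∀ G : Ω → C(K, EuclideanSpace ℝ (Fin d)),
      AEStronglyMeasurable[sigmaAll θ] G P → MemLp G r P →
      ∀ ε > 0, ∃ N₀ : ℕ, ∀ N ≥ N₀, ∃ w : Fin N → Ω → EuclideanSpace ℝ (Fin d),
        (∀ j, Measurable[sigmaAll θ] (w j)) ∧
        MemLp (fun ω => rbfSum K α (τ N) (fun j => θ j ω) (fun j => w j ω)) r P ∧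
        eLpNorm (fun ω => rbfSum K α (τ N) (fun j => θ j ω) (fun j => w j ω) - G ω) r P < ε) ∧
    -- approximation of the solution of the initial value problem
    (∀ (f : ℝ → EuclideanSpace ℝ (Fin d) → EuclideanSpace ℝ (Fin d))
      (u₀ : EuclideanSpace ℝ (Fin d)),
      (∀ x, ContinuousOn (fun t => f t x) (Icc t₀ T)) → LocallyLipschitzInState f t₀ T →
      (GloballyLipschitzInState f t₀ T → ∃ u, IsIVPSolution f t₀ T u₀ u) ∧
      (∀ u v, IsIVPSolution f t₀ T u₀ u → IsIVPSolution f t₀ T u₀ v → EqOn u v (Icc t₀ T)) ∧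
      (∀ u (hu : IsIVPSolution f t₀ T u₀ u),
        ∀ ε > 0, ∃ N₀ : ℕ, ∀ N ≥ N₀, ∃ w : Fin N → Ω → EuclideanSpace ℝ (Fin d),
          (∀ j, Measurable[sigmaFirst θ N] (w j)) ∧
          MemLp (fun ω => rpnn K t₀ u₀ α (τ N) (fun j => θ j ω) (fun j => w j ω)) r P ∧
          eLpNorm (fun ω => rpnn K t₀ u₀ α (τ N) (fun j => θ j ω) (fun j => w j ω)
            - hu.toC hK) r P < ε)) := by
  refine ⟨fun G hG hGr ε hε => (isApproximable_of_memLp hT hα hτ hθ hr hr' hΘpos hG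
    hGr).exists_weights hθ.measurable (fun _ => hθ.sigmaAll_le) hGr hε, ?_⟩
  intro f u₀ hc hf
  refine ⟨exists_isIVPSolution_of_globallyLipschitz hT u₀ hc, fun u v hu hv => hu.unique hf hv,
    fun u hu ε hε => ?_⟩
  obtain ⟨g, hg⟩ := hu.exists_slope hT hK
  have hle : ∀ N, sigmaFirst θ N ≤ (inferInstance : MeasurableSpace Ω) := fun N =>
    (sigmaFirst_le_sigmaAll θ N).trans hθ.sigmaAll_le
  have happ : IsApproximable K α τ P θ r (sigmaFirst θ) (fun _ => g) := by
    have := isApproximable_indicator_const hT hα hτ hθ hr hr' hΘpos hle (fun _ => le_rfl) g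
      (S := univ) fun _ => MeasurableSet.univ
    rwa [indicator_univ] at this
  -- The factor `t - t₀` in the network enlarges the error of the feature sum by at most `T - t₀`.
  obtain ⟨c, hc0, hcε⟩ : ∃ c : ℝ≥0∞, 0 < c ∧ ENNReal.ofReal (T - t₀) * c ≤ ε :=
    ⟨ε / ENNReal.ofReal (T - t₀), ENNReal.div_pos hε.ne' ENNReal.ofReal_ne_top, ENNReal.mul_div_le⟩
  obtain ⟨N₀, h⟩ := happ.exists_weights hθ.measurable hle (memLp_const g) hc0
  refine ⟨N₀, fun N hN => ?_⟩
  obtain ⟨w, hw, -, hn⟩ := h N hN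
  have hlt : eLpNorm (fun ω => rpnn K t₀ u₀ α (τ N) (fun j => θ j ω) (fun j => w j ω)
      - hu.toC hK) r P < ε := by
    refine (eLpNorm_le_mul_eLpNorm_of_ae_le_mul (ae_of_all _ fun ω =>
      norm_rpnn_sub_le hT hK (v := hu.toC hK) hg _ _ _) r).trans_lt (lt_of_lt_of_le ?_ hcε)
    exact ENNReal.mul_lt_mul_right (by simpa using hT) ENNReal.ofReal_ne_top hn
  exact ⟨w, hw, memLp_of_eLpNorm_sub_lt (stronglyMeasurable_rpnn K t₀ u₀ α (τ N) hθ.measurable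
    fun j => (hw j).mono (hle N) le_rfl).aestronglyMeasurable (memLp_const _) hlt, hlt⟩
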